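/- Let $\mathcal H$ be a complex Hilbert space, let $A,B$ be self-adjoint compact operators on $\mathcal H$ (observables), and let $\rho$ be a state, i.e. a positive trace class operator with $\mathrm{tr}\,\rho=1$. Write $\sigma(A)$ for the spectrum of $A$, $P_A(a)$ for the spectral projection of $A$ at $a\in\sigma(A)$ (the orthogonal projection onto $\ker(A-a)$), $\Pi_A(a)(\rho)=P_A(a)\,\rho\,P_A(a)$ and $\Lambda_A(\rho)=\sum_{a\in\sigma(A)}\Pi_A(a)(\rho)$ (a series that converges unconditionally in trace norm), and similarly for $B$. Put $$\langle A\to B\rangle^{\mathrm{op}}_\rho=\sum_{a\in\sigma(A),\,b\in\sigma(B)}ab\,\mathrm{tr}[\Pi_A(a)(\rho)P_B(b)],\qquad \mathrm{Inv}_A(\rho)=\|\Lambda_A(\rho)-\rho\|_1,$$ where $\|\cdot\|_1$ is the trace norm, and, for $\alpha\in\mathbb R$, $$A\circ_\alpha B=\alpha AB+(1-\alpha)BA,\qquad \langle A\circ_\alpha B\rangle_\rho=\mathrm{tr}[\rho\,(A\circ_\alpha B)].$$ All these traces are traces of trace class operators, the double series converges absolutely, and $\mathrm{Inv}_A(\rho)<\infty$.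 For every $\alpha\in\mathbb R$, $$\bigl|\langle A\to B\rangle^{\mathrm{op}}_\rho-\langle A\circ_\alpha B\rangle_\rho\bigr|\le\|A\circ_\alpha B\|\,\mathrm{Inv}_A(\rho),$$ where $\|\cdot\|$ is the operator norm. In particular, for $\alpha\in[0,1]$, $$\bigl|\langle A\to B\rangle^{\mathrm{op}}_\rho-\langle A\circ_\alpha B\rangle_\rho\bigr|\le\|A\|\,\|B\|\,\mathrm{Inv}_A(\rho).$$ -/

import Mathlib

open scoped ENNReal InnerProductSpace

noncomputable section

namespace QuantumCorrelation

variable {H : Type*} [NormedAddCommGroup H] [InnerProductSpace ℂ H] [CompleteSpace H]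

variable (H) in
/-- The index set of a fixed orthonormal (Hilbert) basis of `H`, as a set of vectors. -/
def basisSet : Set H := Classical.choose (exists_hilbertBasis ℂ H)

variable (H) in
/-- A fixed orthonormal (Hilbert) basis of `H`. Trace and trace norm do not depend on it. -/
def basis : HilbertBasis (basisSet H) ℂ H :=
  Classical.choose (Classical.choose_spec (exists_hilbertBasis ℂ H))

/-- The trace norm `‖T‖₁ = tr |T| = ∑ᵢ ⟨eᵢ, |T| eᵢ⟩` with `|T| = √(T† T)`. It is a sum of
nonnegative terms with values in `[0, ∞]`; it is `∞` when `T` is not trace class. -/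
def traceNorm (T : H →L[ℂ] H) : ℝ≥0∞ :=
  ∑' i, ENNReal.ofReal (⟪basis H i, CFC.abs T (basis H i)⟫_ℂ).re

/-- `T` is a trace class operator. -/
def IsTraceClass (T : H →L[ℂ] H) : Prop := traceNorm T < ∞

/-- The trace `tr T = ∑ᵢ ⟨eᵢ, T eᵢ⟩` of a trace class operator. -/
def trace (T : H →L[ℂ] H) : ℂ := ∑' i, ⟪basis H i, T (basis H i)⟫_ℂ

/-- States: positive trace class operators of trace one. -/
structure IsState (ρ : H →L[ℂ] H) : Prop where
  isPositive : ρ.IsPositive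
  isTraceClass : IsTraceClass ρ
  trace_eq_one : trace ρ = 1

/-- Quantum observables: self-adjoint compact operators. -/
structure IsObservable (A : H →L[ℂ] H) : Prop where
  isSelfAdjoint : IsSelfAdjoint A
  isCompactOperator : IsCompactOperator A

/-- The spectral projection `P_A(a)` of a self-adjoint compact operator `A` at the point `a` of
its spectrum: the orthogonal projection onto `ker (A - a)`. (It is `0` when `a = 0` lies in the
spectrum without being an eigenvalue.) -/
def spectralProj (A : H →L[ℂ] H) (a : ℂ) : H →L[ℂ] H :=
  (A - a • (1 : H →L[ℂ] H)).ker.starProjection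

/-- One branch of the Lüders measurement of `A`: `Π_A(a)(ρ) = P_A(a) ρ P_A(a)`. -/
def luders (A : H →L[ℂ] H) (a : ℂ) (ρ : H →L[ℂ] H) : H →L[ℂ] H :=
  spectralProj A a * ρ * spectralProj A a

/-- The non-selective measurement process `Λ_A(ρ) = ∑_{a ∈ σ(A)} Π_A(a)(ρ)`. -/
def nonselective (A ρ : H →L[ℂ] H) : H →L[ℂ] H :=
  ∑' a : spectrum ℂ A, luders A a ρ

/-- The invasiveness `Inv_A(ρ) = ‖Λ_A(ρ) - ρ‖₁`. -/
def invasiveness (A ρ : H →L[ℂ] H) : ℝ := (traceNorm (nonselective A ρ - ρ)).toReal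

/-- The operational joint probability `P_ρ^{A→B}(a → b) = tr[Π_A(a)(ρ) P_B(b)]`. -/
def opProb (A B ρ : H →L[ℂ] H) (a b : ℂ) : ℂ :=
  trace (luders A a ρ * spectralProj B b)

/-- The operational correlation `⟨A → B⟩_ρ^op = ∑_{a ∈ σ(A), b ∈ σ(B)} a b P_ρ^{A→B}(a → b)`. -/
def opCorr (A B ρ : H →L[ℂ] H) : ℂ :=
  ∑' p : spectrum ℂ A × spectrum ℂ B, (p.1 : ℂ) * (p.2 : ℂ) * opProb A B ρ p.1 p.2

/-- `A ∘_α B = α A B + (1 - α) B A`. -/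
def circ (α : ℝ) (A B : H →L[ℂ] H) : H →L[ℂ] H :=
  (α : ℂ) • (A * B) + (1 - α : ℂ) • (B * A)

/-- The algebraic correlation `⟨A ∘_α B⟩_ρ = tr[ρ (A ∘_α B)]`. -/
def algCorr (α : ℝ) (A B ρ : H →L[ℂ] H) : ℂ := trace (ρ * circ α A B)

end QuantumCorrelation

end

/-! Since A P_A(a) = a P_A(a) = P_A(a) A for a in the spectrum, the branch Π_A(a)(ρ) absorbs its
eigenvalue a as a factor A on either side. Summing over b by the spectral theorem for B, then over
a, yields ⟨A → B⟩ = tr[Λ_A(ρ) A B] and, using cyclicity of the trace, also tr[Λ_A(ρ) B A]. Hence it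
equals tr[Λ_A(ρ) (A ∘_α B)] for every α (`opCorr_eq_trace_mul_circ`). The difference to bound is
tr[(Λ_A(ρ) - ρ)(A ∘_α B)], and |tr(T Y)| ≤ ‖Y‖ ‖T‖₁ (`enorm_trace_mul_le`) finishes.

The analysis rests on Hilbert–Schmidt sums. Factoring T = (W R) R with R = |T|^{1/2} and W a
contraction gives the trace bounds and cyclicity. With R = √ρ, Π_A(a)(ρ) = (R P_A(a))†(R P_A(a)), so
by Parseval the trace norms of the branches sum to ‖ρ‖₁ (`tsum_traceNorm_luders`). -/

noncomputable section

namespace QuantumCorrelation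

/-! ### Douglas factorization -/

section Polar

variable {E F G : Type*} [NormedAddCommGroup E] [InnerProductSpace ℂ E]
  [NormedAddCommGroup F] [InnerProductSpace ℂ F] [CompleteSpace F]
  [NormedAddCommGroup G] [InnerProductSpace ℂ G] [CompleteSpace G]

/-- Douglas factorization: an operator dominated in norm by `e` factors through `e` by a
contraction. -/
theorem exists_contraction_comp_eq (f : E →L[ℂ] F) (e : E →L[ℂ] G) (h : ∀ x, ‖f x‖ ≤ ‖e x‖) :
    ∃ U : G →L[ℂ] F, ‖U‖ ≤ 1 ∧ U ∘L e = f := by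
  let K : Submodule ℂ G := (LinearMap.range (e : E →ₗ[ℂ] G)).topologicalClosure
  have : CompleteSpace K := (Submodule.isClosed_topologicalClosure _).completeSpace_coe
  have hmem : ∀ x, e x ∈ K := fun x => Submodule.le_topologicalClosure _ ⟨x, rfl⟩
  let e' : E →ₗ[ℂ] K := (e : E →ₗ[ℂ] G).codRestrict K hmem
  have hdense : DenseRange e' := by
    intro y
    rw [Metric.mem_closure_iff]
    intro ε hε
    obtain ⟨z, ⟨x, hx⟩, hz⟩ := Metric.mem_closure_iff.1 (show (y : G) ∈ closure _ from y.2) ε hε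
    refine ⟨e' x, ⟨x, rfl⟩, ?_⟩
    rw [Subtype.dist_eq]
    change dist (y : G) (e x) < ε
    rwa [show e x = z from hx]
  have hb : ∀ x, ‖(f : E →ₗ[ℂ] F) x‖ ≤ 1 * ‖e' x‖ := fun x => by
    rw [one_mul]; exact h x
  -- The map e x ↦ f x extends by density to the closed range of e; the projection makes it zero on
  -- the orthogonal complement.
  refine ⟨(f : E →ₗ[ℂ] F).extendOfNorm e' ∘L K.orthogonalProjectionOnto, ?_, ?_⟩
  · refine (ContinuousLinearMap.opNorm_comp_le _ _).trans ?_
    exact mul_le_one₀ (LinearMap.opNorm_extendOfNorm_le hdense zero_le_one hb) (norm_nonneg _)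
      K.orthogonalProjectionOnto_norm_le
  · ext x
    have h1 : K.orthogonalProjectionOnto (e x) = e' x :=
      K.orthogonalProjectionOnto_mem_subspace_eq_self (e' x)
    have h2 := LinearMap.extendOfNorm_eq hdense ⟨1, hb⟩ x
    simpa [h1] using h2

end Polar

/-! ### Parseval and inequalities in `[0, ∞]` -/

section Norms

variable {H : Type*} [NormedAddCommGroup H] [InnerProductSpace ℂ H]

theorem enorm_le_one_of_norm_le_one {E : Type*} [SeminormedAddCommGroup E] {x : E}
    (h : ‖x‖ ≤ 1) : ‖x‖ₑ ≤ 1 := by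
  rw [← ofReal_norm]; exact ENNReal.ofReal_le_one.2 h

theorem enorm_apply_le (T : H →L[ℂ] H) (x : H) : ‖T x‖ₑ ≤ ‖T‖ₑ * ‖x‖ₑ :=
  T.le_opENorm x

theorem ofReal_re_inner_self (x : H) : ENNReal.ofReal (⟪x, x⟫_ℂ).re = ‖x‖ₑ ^ 2 := by
  have : (⟪x, x⟫_ℂ).re = ‖x‖ ^ 2 := inner_self_eq_norm_sq (𝕜 := ℂ) x
  rw [this, ENNReal.ofReal_pow (norm_nonneg _), ofReal_norm]

theorem enorm_inner_le (x y : H) : ‖⟪x, y⟫_ℂ‖ₑ ≤ ‖x‖ₑ * ‖y‖ₑ := by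
  rw [← ofReal_norm, ← ofReal_norm, ← ofReal_norm, ← ENNReal.ofReal_mul (norm_nonneg _)]
  exact ENNReal.ofReal_le_ofReal (norm_inner_le_norm x y)

theorem two_mul_mul_le_sq_add_sq (a b : ℝ≥0∞) : 2 * (a * b) ≤ a ^ 2 + b ^ 2 := by
  rcases eq_or_ne a ∞ with rfl | ha
  · simp
  rcases eq_or_ne b ∞ with rfl | hb
  · simp
  lift a to NNReal using ha
  lift b to NNReal using hb
  norm_cast
  rw [← mul_assoc]
  exact two_mul_le_add_sq a b

theorem tsum_enorm_inner_sq {ι : Type*} (b : HilbertBasis ι ℂ H) (x : H) :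
    ∑' i, ‖⟪b i, x⟫_ℂ‖ₑ ^ 2 = ‖x‖ₑ ^ 2 := by
  have h := b.hasSum_inner_mul_inner x x
  have h2 : HasSum (fun i => ‖⟪b i, x⟫_ℂ‖ ^ 2) (‖x‖ ^ 2) := by
    have h3 := Complex.hasSum_re h
    have h4 : (⟪x, x⟫_ℂ).re = ‖x‖ ^ 2 := inner_self_eq_norm_sq (𝕜 := ℂ) x
    rw [h4] at h3
    refine h3.congr_fun ?_
    intro i
    rw [← inner_conj_symm x, ← Complex.normSq_eq_conj_mul_self, Complex.ofReal_re,
      Complex.normSq_eq_norm_sq]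
  rw [← ofReal_norm, ← ENNReal.ofReal_pow (norm_nonneg _), ← h2.tsum_eq,
    ENNReal.ofReal_tsum_of_nonneg (fun i => by positivity) h2.summable]
  refine tsum_congr fun i => ?_
  rw [← ofReal_norm, ← ENNReal.ofReal_pow (norm_nonneg _)]

theorem enorm_one_le : ‖(1 : H →L[ℂ] H)‖ₑ ≤ 1 :=
  enorm_le_one_of_norm_le_one ContinuousLinearMap.norm_id_le

theorem summable_prod_of_enorm {α β : Type*} {f : α → β → ℂ}
    (h : ∑' a, ∑' b, ‖f a b‖ₑ < ∞) : Summable (Function.uncurry f) := by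
  refine Summable.of_enorm ?_
  rw [ENNReal.tsum_prod']
  exact h.ne

theorem tsum_tsum_enorm_mul_lt_top {α β : Type*} {f g : α → β → ℝ≥0∞}
    (hf : ∑' a, ∑' b, f a b ^ 2 < ∞) (hg : ∑' a, ∑' b, g a b ^ 2 < ∞) :
    ∑' a, ∑' b, f a b * g a b < ∞ := by
  have h : 2 * ∑' a, ∑' b, f a b * g a b ≤ ∑' a, ∑' b, f a b ^ 2 + ∑' a, ∑' b, g a b ^ 2 := by
    simp_rw [← ENNReal.tsum_add, ← ENNReal.tsum_mul_left]
    exact ENNReal.tsum_le_tsum fun a => ENNReal.tsum_le_tsum fun b =>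
      two_mul_mul_le_sq_add_sq _ _
  have h2 := h.trans_lt (ENNReal.add_lt_top.2 ⟨hf, hg⟩)
  refine lt_of_le_of_lt ?_ h2
  exact le_mul_of_one_le_left zero_le (by norm_num)

end Norms

variable {H : Type*} [NormedAddCommGroup H] [InnerProductSpace ℂ H] [CompleteSpace H]

/-! ### Polar decomposition and Hilbert–Schmidt norm -/

theorem norm_abs_apply (T : H →L[ℂ] H) (x : H) : ‖CFC.abs T x‖ = ‖T x‖ := by
  have h1 : IsSelfAdjoint (CFC.abs T) := (CFC.abs_nonneg T).isSelfAdjoint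
  have h2 : ⟪CFC.abs T x, CFC.abs T x⟫_ℂ = ⟪T x, T x⟫_ℂ := by
    rw [← ContinuousLinearMap.adjoint_inner_right, ← ContinuousLinearMap.star_eq_adjoint,
      h1.star_eq, ← mul_apply_eq_comp, CFC.abs_mul_abs, mul_apply_eq_comp,
      ContinuousLinearMap.star_eq_adjoint, ContinuousLinearMap.adjoint_inner_right]
  rw [@norm_eq_sqrt_re_inner ℂ, @norm_eq_sqrt_re_inner ℂ, h2]

theorem exists_eq_mul_abs (T : H →L[ℂ] H) : ∃ U : H →L[ℂ] H, ‖U‖ ≤ 1 ∧ U * CFC.abs T = T :=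
  exists_contraction_comp_eq T (CFC.abs T) fun x => (norm_abs_apply T x).ge

theorem exists_abs_eq_mul (T : H →L[ℂ] H) : ∃ U : H →L[ℂ] H, ‖U‖ ≤ 1 ∧ U * T = CFC.abs T :=
  exists_contraction_comp_eq (CFC.abs T) T fun x => (norm_abs_apply T x).le

/-- The square of the Hilbert–Schmidt norm. -/
def hsNormSq (T : H →L[ℂ] H) : ℝ≥0∞ := ∑' i, ‖T (basis H i)‖ₑ ^ 2

/-- By Parseval both sides are the double sum of squared matrix entries, with the indices exchanged.
-/
theorem hsNormSq_star (T : H →L[ℂ] H) : hsNormSq (star T) = hsNormSq T := by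
  unfold hsNormSq
  simp_rw [← tsum_enorm_inner_sq (basis H) (T _), ← tsum_enorm_inner_sq (basis H) (star T _)]
  rw [ENNReal.tsum_comm]
  refine tsum_congr fun i => tsum_congr fun j => ?_
  rw [ContinuousLinearMap.star_eq_adjoint, ContinuousLinearMap.adjoint_inner_right,
    ← inner_conj_symm, RCLike.enorm_conj]

theorem hsNormSq_mul_le_left (X T : H →L[ℂ] H) : hsNormSq (X * T) ≤ ‖X‖ₑ ^ 2 * hsNormSq T := by
  unfold hsNormSq
  rw [← ENNReal.tsum_mul_left]
  refine ENNReal.tsum_le_tsum fun i => ?_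
  rw [← mul_pow]
  exact pow_le_pow_left₀ zero_le (enorm_apply_le X _) 2

theorem hsNormSq_mul_le_right (T X : H →L[ℂ] H) : hsNormSq (T * X) ≤ ‖X‖ₑ ^ 2 * hsNormSq T := by
  rw [← hsNormSq_star, star_mul, ← hsNormSq_star T]
  refine (hsNormSq_mul_le_left _ _).trans_eq ?_
  congr 2
  rw [← ofReal_norm, ← ofReal_norm, norm_star]

theorem hsNormSq_mul_lt_top_left (X : H →L[ℂ] H) {T : H →L[ℂ] H} (h : hsNormSq T < ∞) :
    hsNormSq (X * T) < ∞ :=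
  (hsNormSq_mul_le_left X T).trans_lt (ENNReal.mul_lt_top (by simp) h)

theorem hsNormSq_mul_lt_top_right {T : H →L[ℂ] H} (X : H →L[ℂ] H) (h : hsNormSq T < ∞) :
    hsNormSq (T * X) < ∞ :=
  (hsNormSq_mul_le_right T X).trans_lt (ENNReal.mul_lt_top (by simp) h)

theorem inner_star_apply (Y : H →L[ℂ] H) (x y : H) : ⟪star Y x, y⟫_ℂ = ⟪x, Y y⟫_ℂ := by
  rw [ContinuousLinearMap.star_eq_adjoint, ContinuousLinearMap.adjoint_inner_left]

theorem two_mul_tsum_enorm_inner_mul_le (Y Z : H →L[ℂ] H) :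
    2 * ∑' i, ‖⟪basis H i, (Y * Z) (basis H i)⟫_ℂ‖ₑ ≤ hsNormSq Y + hsNormSq Z := by
  rw [← hsNormSq_star Y, hsNormSq, hsNormSq, ← ENNReal.tsum_mul_left, ← ENNReal.tsum_add]
  refine ENNReal.tsum_le_tsum fun i => ?_
  rw [mul_apply_eq_comp, ← inner_star_apply]
  exact (mul_le_mul_right (enorm_inner_le _ _) 2).trans (two_mul_mul_le_sq_add_sq _ _)

/-! ### Trace norm and trace class operators -/

theorem traceNorm_eq_hsNormSq_of_abs_eq {T R : H →L[ℂ] H} (h : CFC.abs T = star R * R) :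
    traceNorm T = hsNormSq R := by
  unfold traceNorm hsNormSq
  refine tsum_congr fun i => ?_
  rw [h, mul_apply_eq_comp, ContinuousLinearMap.star_eq_adjoint,
    ContinuousLinearMap.adjoint_inner_right, ofReal_re_inner_self]

theorem traceNorm_star_mul_self (R : H →L[ℂ] H) : traceNorm (star R * R) = hsNormSq R :=
  traceNorm_eq_hsNormSq_of_abs_eq (CFC.abs_of_nonneg _ (star_mul_self_nonneg R))

/-- Every operator factors as `T = W * R * R` a contraction `W` and `R` the square root of `|T|`. -/
theorem exists_contraction_sqrt_factor (T : H →L[ℂ] H) :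
    ∃ W R : H →L[ℂ] H, ‖W‖ ≤ 1 ∧ hsNormSq R = traceNorm T ∧ star R = R ∧ T = W * R * R := by
  obtain ⟨W, hW, hT⟩ := exists_eq_mul_abs T
  have h1 := CFC.sqrt_mul_sqrt_self (CFC.abs T) (CFC.abs_nonneg T)
  have h2 : star (CFC.sqrt (CFC.abs T)) = CFC.sqrt (CFC.abs T) :=
    (CFC.sqrt_nonneg (CFC.abs T)).isSelfAdjoint.star_eq
  refine ⟨W, CFC.sqrt (CFC.abs T), hW, ?_, h2, by rw [mul_assoc, h1, hT]⟩
  exact (traceNorm_eq_hsNormSq_of_abs_eq (by rw [h2, h1])).symm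

/-- Split X T Y = (X W R)(R Y): both factors have squared Hilbert–Schmidt norm at most ‖T‖₁, so the
additive bound 2|yz| ≤ |y|² + |z|² loses nothing. General X and Y follow by scaling. -/
theorem tsum_enorm_inner_mul_mul_le_of_contraction (X T Y : H →L[ℂ] H) (hX : ‖X‖ ≤ 1)
    (hY : ‖Y‖ ≤ 1) :
    ∑' i, ‖⟪basis H i, (X * T * Y) (basis H i)⟫_ℂ‖ₑ ≤ traceNorm T := by
  obtain ⟨W, R, hW, hR, -, hT⟩ := exists_contraction_sqrt_factor T
  have key := two_mul_tsum_enorm_inner_mul_le (X * W * R) (R * Y)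
  have e : X * T * Y = X * W * R * (R * Y) := by rw [hT]; simp only [mul_assoc]
  rw [← e] at key
  have hXW : ‖X * W‖ₑ ^ 2 ≤ 1 :=
    pow_le_one₀ zero_le (enorm_le_one_of_norm_le_one
      ((norm_mul_le _ _).trans (mul_le_one₀ hX (norm_nonneg _) hW)))
  have hY2 : ‖Y‖ₑ ^ 2 ≤ 1 := pow_le_one₀ zero_le (enorm_le_one_of_norm_le_one hY)
  have h1 : hsNormSq (X * W * R) ≤ traceNorm T := by
    rw [← hR]
    exact (hsNormSq_mul_le_left _ _).trans (mul_le_of_le_one_left zero_le hXW)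
  have h2 : hsNormSq (R * Y) ≤ traceNorm T := by
    rw [← hR]
    exact (hsNormSq_mul_le_right _ _).trans (mul_le_of_le_one_left zero_le hY2)
  have h3 := key.trans (add_le_add h1 h2)
  rw [← two_mul] at h3
  exact (ENNReal.mul_le_mul_iff_right two_ne_zero (by simp)).1 h3

theorem exists_eq_norm_smul_contraction (Y : H →L[ℂ] H) :
    ∃ Y' : H →L[ℂ] H, ‖Y'‖ ≤ 1 ∧ Y = (‖Y‖ : ℂ) • Y' := by
  rcases eq_or_ne Y 0 with rfl | h
  · exact ⟨0, by simp, by simp⟩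
  · have h0 : ‖Y‖ ≠ 0 := norm_ne_zero_iff.2 h
    refine ⟨((‖Y‖ : ℂ)⁻¹) • Y, ?_, ?_⟩
    · rw [norm_smul, norm_inv, Complex.norm_real, norm_norm, inv_mul_cancel₀ h0]
    · rw [smul_smul, mul_inv_cancel₀ (by exact_mod_cast h0), one_smul]

theorem tsum_enorm_inner_mul_mul_le (X T Y : H →L[ℂ] H) :
    ∑' i, ‖⟪basis H i, (X * T * Y) (basis H i)⟫_ℂ‖ₑ ≤ ‖X‖ₑ * ‖Y‖ₑ * traceNorm T := by
  obtain ⟨X', hX', hX⟩ := exists_eq_norm_smul_contraction X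
  obtain ⟨Y', hY', hY⟩ := exists_eq_norm_smul_contraction Y
  have e : X * T * Y = ((‖X‖ : ℂ) * (‖Y‖ : ℂ)) • (X' * T * Y') := by
    conv_lhs => rw [hX, hY]
    rw [smul_mul_assoc, smul_mul_assoc, mul_smul_comm, smul_smul]
  have h (i) : ‖⟪basis H i, (X * T * Y) (basis H i)⟫_ℂ‖ₑ =
      ‖X‖ₑ * ‖Y‖ₑ * ‖⟪basis H i, (X' * T * Y') (basis H i)⟫_ℂ‖ₑ := by
    rw [e, smul_apply, inner_smul_right, enorm_mul, enorm_mul]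
    congr 2 <;> rw [← ofReal_norm, Complex.norm_real, norm_norm, ofReal_norm]
  simp_rw [h]
  rw [ENNReal.tsum_mul_left]
  exact mul_le_mul_right (tsum_enorm_inner_mul_mul_le_of_contraction X' T Y' hX' hY') _

/-- `|T|` is the product of `T` with a contraction, which bounds the trace norm by diagonal sums. -/
theorem exists_contraction_traceNorm_le (T : H →L[ℂ] H) : ∃ U : H →L[ℂ] H, ‖U‖ ≤ 1 ∧
    traceNorm T ≤ ∑' i, ‖⟪basis H i, (U * T) (basis H i)⟫_ℂ‖ₑ := by
  obtain ⟨U, hU, hT⟩ := exists_abs_eq_mul T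
  refine ⟨U, hU, ENNReal.tsum_le_tsum fun i => ?_⟩
  rw [hT, ← ofReal_norm]
  exact ENNReal.ofReal_le_ofReal (Complex.re_le_norm _)

theorem traceNorm_mul_mul_le (X T Y : H →L[ℂ] H) :
    traceNorm (X * T * Y) ≤ ‖X‖ₑ * ‖Y‖ₑ * traceNorm T := by
  obtain ⟨U, hU, h⟩ := exists_contraction_traceNorm_le (X * T * Y)
  refine h.trans ?_
  have e : U * (X * T * Y) = U * X * T * Y := by simp only [mul_assoc]
  rw [e]
  refine (tsum_enorm_inner_mul_mul_le _ _ _).trans ?_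
  gcongr
  rw [← ofReal_norm, ← ofReal_norm]
  exact ENNReal.ofReal_le_ofReal ((norm_mul_le _ _).trans
    (mul_le_of_le_one_left (norm_nonneg _) hU))

theorem IsTraceClass.mul_mul {T : H →L[ℂ] H} (hT : IsTraceClass T) (X Y : H →L[ℂ] H) :
    IsTraceClass (X * T * Y) :=
  (traceNorm_mul_mul_le X T Y).trans_lt
    (ENNReal.mul_lt_top (ENNReal.mul_lt_top (by simp) (by simp)) hT)

theorem IsTraceClass.mul_right {T : H →L[ℂ] H} (hT : IsTraceClass T) (Y : H →L[ℂ] H) :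
    IsTraceClass (T * Y) := by
  simpa using hT.mul_mul 1 Y

theorem IsTraceClass.mul_left {T : H →L[ℂ] H} (hT : IsTraceClass T) (X : H →L[ℂ] H) :
    IsTraceClass (X * T) := by
  simpa using hT.mul_mul X 1

theorem tsum_enorm_inner_mul_le (T Y : H →L[ℂ] H) :
    ∑' i, ‖⟪basis H i, (T * Y) (basis H i)⟫_ℂ‖ₑ ≤ ‖Y‖ₑ * traceNorm T := by
  have h := tsum_enorm_inner_mul_mul_le 1 T Y
  rw [one_mul] at h
  refine h.trans ?_
  gcongr
  exact mul_le_of_le_one_left zero_le enorm_one_le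

theorem enorm_trace_mul_le (T Y : H →L[ℂ] H) : ‖trace (T * Y)‖ₑ ≤ ‖Y‖ₑ * traceNorm T :=
  enorm_tsum_le_tsum_enorm.trans (tsum_enorm_inner_mul_le T Y)

theorem IsTraceClass.summable {T : H →L[ℂ] H} (hT : IsTraceClass T) :
    Summable fun i => ⟪basis H i, T (basis H i)⟫_ℂ := by
  have h := tsum_enorm_inner_mul_le T 1
  rw [mul_one] at h
  exact Summable.of_enorm (h.trans_lt (ENNReal.mul_lt_top (by simp) hT)).ne

/-- Countable subadditivity of the trace norm for series that converge in operator norm. -/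
theorem traceNorm_le_tsum {κ : Type*} {f : κ → H →L[ℂ] H} {T : H →L[ℂ] H} (h : HasSum f T) :
    traceNorm T ≤ ∑' k, traceNorm (f k) := by
  -- The one contraction chosen for the sum serves every term.
  obtain ⟨U, hU, hle⟩ := exists_contraction_traceNorm_le T
  have hs (i) : HasSum (fun k => ⟪basis H i, (U * f k) (basis H i)⟫_ℂ)
      ⟪basis H i, (U * T) (basis H i)⟫_ℂ := by
    let φ : (H →L[ℂ] H) →L[ℂ] ℂ := innerSL ℂ (basis H i) ∘L U ∘L
      ContinuousLinearMap.apply ℂ H (basis H i)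
    exact φ.hasSum h
  calc traceNorm T ≤ ∑' i, ‖⟪basis H i, (U * T) (basis H i)⟫_ℂ‖ₑ := hle
    _ ≤ ∑' i, ∑' k, ‖⟪basis H i, (U * f k) (basis H i)⟫_ℂ‖ₑ := by
        refine ENNReal.tsum_le_tsum fun i => ?_
        rw [← (hs i).tsum_eq]
        exact enorm_tsum_le_tsum_enorm
    _ = ∑' k, ∑' i, ‖⟪basis H i, (U * f k) (basis H i)⟫_ℂ‖ₑ := ENNReal.tsum_comm
    _ ≤ ∑' k, traceNorm (f k) := by
        refine ENNReal.tsum_le_tsum fun k => ?_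
        simpa using tsum_enorm_inner_mul_mul_le_of_contraction U (f k) 1 hU
          ContinuousLinearMap.norm_id_le

theorem traceNorm_add_le (S T : H →L[ℂ] H) : traceNorm (S + T) ≤ traceNorm S + traceNorm T := by
  have h : HasSum (fun b : Bool => cond b S T) (S + T) := by
    simpa using hasSum_fintype (fun b : Bool => cond b S T)
  simpa [tsum_fintype] using traceNorm_le_tsum h

theorem IsTraceClass.add {S T : H →L[ℂ] H} (hS : IsTraceClass S) (hT : IsTraceClass T) :
    IsTraceClass (S + T) :=
  (traceNorm_add_le S T).trans_lt (ENNReal.add_lt_top.2 ⟨hS, hT⟩)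

theorem IsTraceClass.sub {S T : H →L[ℂ] H} (hS : IsTraceClass S) (hT : IsTraceClass T) :
    IsTraceClass (S - T) := by
  have h := hS.add (hT.mul_left (-1))
  rwa [neg_one_mul, ← sub_eq_add_neg] at h

/-! ### Linearity and cyclicity of the trace -/

theorem trace_sub {S T : H →L[ℂ] H} (hS : IsTraceClass S) (hT : IsTraceClass T) :
    trace (S - T) = trace S - trace T := by
  unfold trace
  rw [← hS.summable.tsum_sub hT.summable]
  simp

theorem trace_smul (c : ℂ) (T : H →L[ℂ] H) : trace (c • T) = c * trace T := by
  unfold trace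
  simp [tsum_mul_left]

theorem trace_add {S T : H →L[ℂ] H} (hS : IsTraceClass S) (hT : IsTraceClass T) :
    trace (S + T) = trace S + trace T := by
  unfold trace
  rw [← hS.summable.tsum_add hT.summable]
  simp

/-- Both traces are the double sum of Y_ij Z_ji, which the Hilbert–Schmidt bounds make absolutely
convergent. -/
theorem trace_mul_comm_of_hsNormSq {Y Z : H →L[ℂ] H} (hY : hsNormSq Y < ∞)
    (hZ : hsNormSq Z < ∞) : trace (Y * Z) = trace (Z * Y) := by
  have hexp (Y Z : H →L[ℂ] H) (i) : ∑' j, ⟪basis H i, Y (basis H j)⟫_ℂ *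
      ⟪basis H j, Z (basis H i)⟫_ℂ = ⟪basis H i, (Y * Z) (basis H i)⟫_ℂ := by
    rw [mul_apply_eq_comp, ← inner_star_apply,
      ← (basis H).tsum_inner_mul_inner (star Y (basis H i))]
    simp_rw [inner_star_apply]
  have hsum : Summable (Function.uncurry fun i j => ⟪basis H i, Y (basis H j)⟫_ℂ *
      ⟪basis H j, Z (basis H i)⟫_ℂ) := by
    apply summable_prod_of_enorm
    simp_rw [enorm_mul]
    apply tsum_tsum_enorm_mul_lt_top
    · rw [ENNReal.tsum_comm]
      simp_rw [tsum_enorm_inner_sq]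
      exact hY
    · simp_rw [tsum_enorm_inner_sq]
      exact hZ
  unfold trace
  simp_rw [← hexp]
  rw [hsum.tsum_comm.symm]
  simp_rw [mul_comm]

/-- As X is only bounded, the two Hilbert–Schmidt factors W R and R of T are moved past it one at a
time. -/
theorem trace_mul_comm {T : H →L[ℂ] H} (hT : IsTraceClass T) (X : H →L[ℂ] H) :
    trace (T * X) = trace (X * T) := by
  obtain ⟨W, R, hW, hR, -, hTR⟩ := exists_contraction_sqrt_factor T
  have hR' : hsNormSq R < ∞ := hR.trans_lt hT
  calc trace (T * X) = trace (W * R * (R * X)) := by rw [hTR]; simp only [mul_assoc]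
    _ = trace (R * X * (W * R)) := trace_mul_comm_of_hsNormSq
        (hsNormSq_mul_lt_top_left _ hR') (hsNormSq_mul_lt_top_right _ hR')
    _ = trace (R * (X * W * R)) := by simp only [mul_assoc]
    _ = trace (X * W * R * R) := trace_mul_comm_of_hsNormSq hR'
        (hsNormSq_mul_lt_top_left _ hR')
    _ = trace (X * T) := by rw [hTR]; simp only [mul_assoc]

theorem enorm_trace_star_mul_self_le (Z : H →L[ℂ] H) : ‖trace (star Z * Z)‖ₑ ≤ hsNormSq Z := by
  refine enorm_tsum_le_tsum_enorm.trans (ENNReal.tsum_le_tsum fun i => ?_)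
  rw [mul_apply_eq_comp, ContinuousLinearMap.star_eq_adjoint,
    ContinuousLinearMap.adjoint_inner_right, sq]
  exact enorm_inner_le _ _

/-! ### Resolutions of the identity and the spectral theorem -/

section Eigenspace

variable {H : Type*} [NormedAddCommGroup H] [InnerProductSpace ℂ H]

theorem ker_sub_smul_eq_eigenspace (A : H →L[ℂ] H) (a : ℂ) :
    (A - a • (1 : H →L[ℂ] H)).ker = Module.End.eigenspace (A : H →ₗ[ℂ] H) a := by
  ext x
  rw [Module.End.mem_eigenspace_iff]
  exact sub_eq_zero

theorem mem_spectrum_of_eigenspace_ne_bot {A : H →L[ℂ] H} {a : ℂ}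
    (h : Module.End.eigenspace (A : H →ₗ[ℂ] H) a ≠ ⊥) : a ∈ spectrum ℂ A := by
  obtain ⟨x, hx, hx0⟩ := (Submodule.ne_bot_iff _).1 h
  rw [Module.End.mem_eigenspace_iff] at hx
  intro hu
  obtain ⟨u, hu⟩ := hu
  apply hx0
  have h1 : (u : H →L[ℂ] H) x = 0 := by
    rw [hu, Algebra.algebraMap_eq_smul_one]
    exact sub_eq_zero.2 hx.symm
  have h2 : ((↑u⁻¹ : H →L[ℂ] H) * (u : H →L[ℂ] H)) x = 0 := by
    rw [mul_apply_eq_comp, h1, map_zero]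
  simpa using h2

end Eigenspace

/-- A family of orthogonal projections that sums strongly to the identity. -/
structure IsResolution {κ : Type*} (P : κ → H →L[ℂ] H) : Prop where
  isStarProjection : ∀ k, IsStarProjection (P k)
  hasSum : ∀ x, HasSum (fun k => P k x) x

theorem inner_apply_apply_of_isStarProjection {P : H →L[ℂ] H} (hP : IsStarProjection P)
    (x y : H) : ⟪P x, P y⟫_ℂ = ⟪x, P y⟫_ℂ := by
  conv_lhs => rw [← hP.isSelfAdjoint.star_eq]
  rw [inner_star_apply, hP.isSelfAdjoint.star_eq, ← mul_apply_eq_comp, hP.isIdempotentElem.eq]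

namespace IsResolution

variable {κ : Type*} {P : κ → H →L[ℂ] H}

/-- Pair the expansion of x with x and use ‖P x‖² = ⟨x, P x⟩. -/
theorem tsum_enorm_sq (hP : IsResolution P) (x : H) : ∑' k, ‖P k x‖ₑ ^ 2 = ‖x‖ₑ ^ 2 := by
  have h1 : HasSum (fun k => ⟪x, P k x⟫_ℂ) ⟪x, x⟫_ℂ := (innerSL ℂ x).hasSum (hP.hasSum x)
  have h2 : HasSum (fun k => (⟪P k x, P k x⟫_ℂ).re) (⟪x, x⟫_ℂ).re := by
    simp_rw [inner_apply_apply_of_isStarProjection (hP.isStarProjection _)]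
    exact Complex.hasSum_re h1
  rw [← ofReal_re_inner_self, ← h2.tsum_eq, ENNReal.ofReal_tsum_of_nonneg
    (fun k => show 0 ≤ (⟪P k x, P k x⟫_ℂ).re from inner_self_nonneg (𝕜 := ℂ)) h2.summable]
  simp_rw [ofReal_re_inner_self]

theorem tsum_hsNormSq_mul (hP : IsResolution P) (Z : H →L[ℂ] H) :
    ∑' k, hsNormSq (Z * P k) = hsNormSq Z := by
  have h (k) : hsNormSq (Z * P k) = hsNormSq (P k * star Z) := by
    rw [← hsNormSq_star, star_mul, (hP.isStarProjection k).isSelfAdjoint.star_eq]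
  simp_rw [h]
  rw [← hsNormSq_star Z]
  unfold hsNormSq
  rw [ENNReal.tsum_comm]
  simp_rw [mul_apply_eq_comp, hP.tsum_enorm_sq]

/-- Cyclicity gives tr(T P_k) = ∑ᵢ ⟨P_k R† eᵢ, P_k W R eᵢ⟩. Parseval makes the double family
absolutely summable, so the sums over k and i may be exchanged. -/
theorem hasSum_trace_mul (hP : IsResolution P) {T : H →L[ℂ] H} (hT : IsTraceClass T) :
    HasSum (fun k => trace (T * P k)) (trace T) := by
  obtain ⟨W, R, hW, hR, -, hTR⟩ := exists_contraction_sqrt_factor T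
  have hR' : hsNormSq R < ∞ := hR.trans_lt hT
  have hWR : hsNormSq (W * R) < ∞ := hsNormSq_mul_lt_top_left W hR'
  set f : κ → basisSet H → ℂ := fun k i => ⟪P k (star R (basis H i)), P k ((W * R) (basis H i))⟫_ℂ
  have hk (k) : ∑' i, f k i = trace (T * P k) := by
    rw [hTR, mul_assoc, trace_mul_comm_of_hsNormSq hWR (hsNormSq_mul_lt_top_right _ hR')]
    refine tsum_congr fun i => ?_
    simp only [f]
    rw [inner_apply_apply_of_isStarProjection (hP.isStarProjection k), inner_star_apply]
    rfl
  have hi (i) : HasSum (fun k => f k i) ⟪basis H i, (R * (W * R)) (basis H i)⟫_ℂ := by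
    simp only [f]
    simp_rw [inner_apply_apply_of_isStarProjection (hP.isStarProjection _)]
    rw [mul_apply_eq_comp R, ← inner_star_apply R]
    exact (innerSL ℂ (star R (basis H i))).hasSum (hP.hasSum _)
  have hsum : Summable (Function.uncurry f) := by
    apply summable_prod_of_enorm
    refine lt_of_le_of_lt (ENNReal.tsum_le_tsum fun k => ENNReal.tsum_le_tsum fun i =>
      enorm_inner_le _ _) (tsum_tsum_enorm_mul_lt_top ?_ ?_) <;>
    · rw [ENNReal.tsum_comm]
      simp_rw [hP.tsum_enorm_sq]
      first | exact hWR | exact (hsNormSq_star R).trans_lt hR'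
  have h1 : HasSum (fun k => ∑' i, f k i) (∑' k, ∑' i, f k i) := hsum.prod.hasSum
  simp_rw [hk] at h1
  convert h1 using 1
  simp_rw [← hk]
  rw [← hsum.tsum_comm]
  simp_rw [(hi _).tsum_eq]
  rw [hTR, trace_mul_comm_of_hsNormSq hWR hR']
  rfl

end IsResolution

theorem isStarProjection_spectralProj (A : H →L[ℂ] H) (a : ℂ) :
    IsStarProjection (spectralProj A a) := by
  unfold spectralProj
  exact isStarProjection_starProjection

theorem mul_spectralProj (A : H →L[ℂ] H) (a : ℂ) :
    A * spectralProj A a = a • spectralProj A a := by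
  ext x
  have h : spectralProj A a x ∈ (A - a • (1 : H →L[ℂ] H)).ker :=
    Submodule.starProjection_apply_mem _ x
  have h2 : A (spectralProj A a x) - a • spectralProj A a x = 0 := h
  exact sub_eq_zero.1 h2

theorem spectralProj_mul {A : H →L[ℂ] H} (hA : IsSelfAdjoint A) {a : ℂ}
    (ha : a ∈ spectrum ℂ A) : spectralProj A a * A = a • spectralProj A a := by
  have h := congrArg star (mul_spectralProj A a)
  have ha' : star a = a := by
    rw [hA.mem_spectrum_eq_re ha]; exact Complex.conj_ofReal _
  rwa [star_mul, star_smul, (isStarProjection_spectralProj A a).isSelfAdjoint.star_eq, hA.star_eq,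
    ha'] at h

/-- The spectral theorem: the spectral projections of an observable resolve the identity. -/
theorem IsObservable.isResolution {A : H →L[ℂ] H} (hA : IsObservable A) :
    IsResolution fun a : spectrum ℂ A => spectralProj A a := by
  refine ⟨fun a => isStarProjection_spectralProj A a, fun x => ?_⟩
  have hsym := ContinuousLinearMap.isSelfAdjoint_iff_isSymmetric.1 hA.isSelfAdjoint
  let V : spectrum ℂ A → Submodule ℂ H := fun a => (A - (a : ℂ) • (1 : H →L[ℂ] H)).ker
  have hV (a) : V a = Module.End.eigenspace (A : H →ₗ[ℂ] H) a := ker_sub_smul_eq_eigenspace A a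
  have hcomp (a) : CompleteSpace (V a) :=
    (ContinuousLinearMap.isClosed_ker (A - (a : ℂ) • (1 : H →L[ℂ] H))).completeSpace_coe
  have hperp {a b : spectrum ℂ A} (hab : a ≠ b) {v w : H} (hv : v ∈ V a) (hw : w ∈ V b) :
      ⟪v, w⟫_ℂ = 0 := by
    rw [hV] at hv hw
    exact hsym.orthogonalFamily_eigenspaces (fun h => hab (Subtype.ext h)) ⟨v, hv⟩ ⟨w, hw⟩
  have hortho : OrthogonalFamily ℂ (fun a => V a) fun a => (V a).subtypeₗᵢ :=
    fun a b hab v w => hperp hab v.2 w.2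
  have htot : ⊤ ≤ (⨆ a, V a).topologicalClosure := by
    rw [top_le_iff, Submodule.topologicalClosure_eq_top_iff, ← le_bot_iff,
      ← ContinuousLinearMap.orthogonalComplement_iSup_eigenspaces_eq_bot hA.isCompactOperator hsym]
    -- Eigenspaces off the spectrum are zero, so indexing by the spectrum loses none.
    refine Submodule.orthogonal_le (iSup_le fun a => ?_)
    by_cases h : Module.End.eigenspace (A : H →ₗ[ℂ] H) a = ⊥
    · rw [h]; exact bot_le
    · rw [← hV ⟨a, mem_spectrum_of_eigenspace_ne_bot h⟩]
      exact le_iSup V _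
  have hH := IsHilbertSum.mkInternal V hortho htot
  have hs := hH.hasSum_linearIsometryEquiv_symm (hH.linearIsometryEquiv x)
  rw [LinearIsometryEquiv.symm_apply_apply] at hs
  convert hs using 2 with a
  -- Applying P_A(a) to the expansion of x leaves only its component at a.
  have h1 := (spectralProj A a).hasSum hs
  refine h1.unique ?_
  have h2 := hasSum_single (f := fun b => spectralProj A a
    ((V b).subtypeₗᵢ (hH.linearIsometryEquiv x b))) a ?_
  · convert h2 using 1
    exact (Submodule.starProjection_eq_self_iff.2 (hH.linearIsometryEquiv x a).2).symm
  · intro b hb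
    refine (Submodule.starProjection_apply_eq_zero_iff _).2 ?_
    intro v hv
    exact hperp hb.symm hv (hH.linearIsometryEquiv x b).2

/-! ### Convergence of the Lüders series -/

/-- Turns summable trace norms of the branches into convergence in operator norm, which defines
Λ_A(ρ). -/
theorem enorm_star_mul_self_le (Z : H →L[ℂ] H) : ‖star Z * Z‖ₑ ≤ hsNormSq Z := by
  rcases eq_or_ne (hsNormSq Z) ∞ with h | h
  · simp [h]
  have hx (x : H) : ‖Z x‖ ^ 2 ≤ (hsNormSq Z).toReal * ‖x‖ ^ 2 := by
    have h1 : ‖Z x‖ₑ ^ 2 ≤ hsNormSq Z * ‖x‖ₑ ^ 2 := by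
      rw [← tsum_enorm_inner_sq (basis H), ← hsNormSq_star, hsNormSq, ← ENNReal.tsum_mul_right]
      refine ENNReal.tsum_le_tsum fun i => ?_
      rw [← inner_star_apply, ← mul_pow]
      exact pow_le_pow_left₀ zero_le (enorm_inner_le _ _) 2
    have h2 := ENNReal.toReal_mono (ENNReal.mul_ne_top h (by simp)) h1
    simpa using h2
  have hn : ‖Z‖ ≤ Real.sqrt (hsNormSq Z).toReal := by
    refine Z.opNorm_le_bound (Real.sqrt_nonneg _) fun x => ?_
    rw [← Real.sqrt_sq (norm_nonneg x), ← Real.sqrt_mul ENNReal.toReal_nonneg]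
    exact Real.le_sqrt_of_sq_le (hx x)
  rw [← ofReal_norm]
  refine ENNReal.ofReal_le_of_le_toReal ?_
  rw [CStarRing.norm_star_mul_self, ← Real.mul_self_sqrt (ENNReal.toReal_nonneg (a := hsNormSq Z))]
  exact mul_self_le_mul_self (norm_nonneg _) hn

theorem exists_sqrt_of_isPositive {ρ : H →L[ℂ] H} (hρ : ρ.IsPositive) :
    ∃ R : H →L[ℂ] H, star R = R ∧ R * R = ρ ∧ hsNormSq R = traceNorm ρ := by
  have h0 : 0 ≤ ρ := (ContinuousLinearMap.nonneg_iff_isPositive ρ).2 hρ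
  have h1 := CFC.sqrt_mul_sqrt_self ρ h0
  have h2 : star (CFC.sqrt ρ) = CFC.sqrt ρ := (CFC.sqrt_nonneg ρ).isSelfAdjoint.star_eq
  refine ⟨CFC.sqrt ρ, h2, h1, ?_⟩
  rw [← traceNorm_star_mul_self, h2, h1]

theorem luders_eq_star_mul_self {A R ρ : H →L[ℂ] H} (hR : star R = R) (hRρ : R * R = ρ) (a : ℂ) :
    luders A a ρ = star (R * spectralProj A a) * (R * spectralProj A a) := by
  rw [star_mul, hR, (isStarProjection_spectralProj A a).isSelfAdjoint.star_eq, luders, ← hRρ]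
  simp only [mul_assoc]

variable {A B ρ : H →L[ℂ] H}

theorem tsum_traceNorm_luders (hA : IsObservable A) (hρ : IsState ρ) :
    ∑' a : spectrum ℂ A, traceNorm (luders A a ρ) = traceNorm ρ := by
  obtain ⟨R, hR, hRρ, hRn⟩ := exists_sqrt_of_isPositive hρ.isPositive
  simp_rw [luders_eq_star_mul_self hR hRρ, traceNorm_star_mul_self]
  rw [hA.isResolution.tsum_hsNormSq_mul, hRn]

theorem hasSum_luders (hA : IsObservable A) (hρ : IsState ρ) :
    HasSum (fun a : spectrum ℂ A => luders A a ρ) (nonselective A ρ) := by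
  obtain ⟨R, hR, hRρ, hRn⟩ := exists_sqrt_of_isPositive hρ.isPositive
  refine (Summable.of_enorm ?_).hasSum
  refine (lt_of_le_of_lt (ENNReal.tsum_le_tsum fun a => ?_)
    ((tsum_traceNorm_luders hA hρ).trans_lt hρ.isTraceClass)).ne
  rw [luders_eq_star_mul_self hR hRρ, traceNorm_star_mul_self]
  exact enorm_star_mul_self_le _

theorem tendsto_traceNorm_nonselective_sub (hA : IsObservable A) (hρ : IsState ρ) :
    Filter.Tendsto (fun F : Finset (spectrum ℂ A) =>
      traceNorm (nonselective A ρ - ∑ a ∈ F, luders A a ρ)) Filter.atTop (nhds 0) := by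
  have h := ENNReal.tendsto_tsum_compl_atTop_zero
    ((tsum_traceNorm_luders hA hρ).trans_lt hρ.isTraceClass).ne
  refine tendsto_of_tendsto_of_tendsto_of_le_of_le tendsto_const_nhds h
    (fun _ => zero_le) fun F => ?_
  -- The remainder is the sum of the branches outside F, so its trace norm is at most the tail of a
  -- convergent series.
  refine traceNorm_le_tsum (f := fun a : {a // a ∉ F} => luders A (a : spectrum ℂ A) ρ) ?_
  rw [Finset.hasSum_compl_iff F (f := fun a : spectrum ℂ A => luders A a ρ), sub_add_cancel]
  exact hasSum_luders hA hρ

theorem isTraceClass_luders (hρ : IsState ρ) (a : ℂ) : IsTraceClass (luders A a ρ) :=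
  hρ.isTraceClass.mul_mul _ _

theorem isTraceClass_nonselective (hA : IsObservable A) (hρ : IsState ρ) :
    IsTraceClass (nonselective A ρ) :=
  (traceNorm_le_tsum (hasSum_luders hA hρ)).trans_lt
    ((tsum_traceNorm_luders hA hρ).trans_lt hρ.isTraceClass)

theorem sub_sum_trace {κ : Type*} (f : κ → H →L[ℂ] H) (hf : ∀ k, IsTraceClass (f k))
    {T : H →L[ℂ] H} (hT : IsTraceClass T) (F : Finset κ) :
    IsTraceClass (T - ∑ k ∈ F, f k) ∧
      trace (T - ∑ k ∈ F, f k) = trace T - ∑ k ∈ F, trace (f k) := by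
  classical
  induction F using Finset.induction_on with
  | empty => simpa using hT
  | insert k F hk ih =>
    rw [Finset.sum_insert hk, Finset.sum_insert hk, add_comm, ← sub_sub, add_comm, ← sub_sub]
    exact ⟨ih.1.sub (hf k), by rw [trace_sub ih.1 (hf k), ih.2]⟩

/-- T ↦ tr(T X) is Lipschitz for the trace norm. -/
theorem hasSum_trace_luders_mul (hA : IsObservable A) (hρ : IsState ρ) (X : H →L[ℂ] H) :
    HasSum (fun a : spectrum ℂ A => trace (luders A a ρ * X)) (trace (nonselective A ρ * X)) := by
  have hlim := ENNReal.Tendsto.const_mul (a := ‖X‖ₑ) (tendsto_traceNorm_nonselective_sub hA hρ)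
    (Or.inr (by simp))
  rw [mul_zero] at hlim
  rw [HasSum, SummationFilter.unconditional_filter, tendsto_iff_edist_tendsto_0]
  refine tendsto_of_tendsto_of_tendsto_of_le_of_le tendsto_const_nhds hlim
    (fun _ => zero_le) fun F => ?_
  have h := (sub_sum_trace (fun a : spectrum ℂ A => luders A a ρ * X)
    (fun a => (isTraceClass_luders hρ a).mul_right X)
    ((isTraceClass_nonselective hA hρ).mul_right X) F).2
  rw [← Finset.sum_mul, ← sub_mul] at h
  change edist (∑ a ∈ F, trace (luders A a ρ * X)) _ ≤ _
  rw [edist_comm, edist_eq_enorm_sub, ← h]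
  exact enorm_trace_mul_le _ _

/-! ### The operational correlation as a trace -/

/-- As P_B(b) is idempotent, cyclicity turns the probability into tr(Z† Z) with Z = R P_A(a) P_B(b).
-/
theorem enorm_opProb_le {R : H →L[ℂ] H} (hρ : IsState ρ) (hR : star R = R) (hRρ : R * R = ρ)
    (a b : ℂ) : ‖opProb A B ρ a b‖ₑ ≤ hsNormSq (R * spectralProj A a * spectralProj B b) := by
  refine le_trans (le_of_eq ?_) (enorm_trace_star_mul_self_le _)
  have hP := isStarProjection_spectralProj A a
  have hQ := isStarProjection_spectralProj B b
  congr 1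
  rw [opProb]
  conv_lhs => rw [← hQ.isIdempotentElem.eq, ← mul_assoc]
  rw [trace_mul_comm ((isTraceClass_luders hρ a).mul_right _), luders_eq_star_mul_self hR hRρ,
    star_mul (R * _), hQ.isSelfAdjoint.star_eq]
  simp only [mul_assoc]

theorem enorm_le_of_mem_spectrum {a : ℂ} (ha : a ∈ spectrum ℂ A) : ‖a‖ₑ ≤ ‖A‖ₑ := by
  rw [← ofReal_norm, ← ofReal_norm]
  refine ENNReal.ofReal_le_ofReal ((spectrum.norm_le_norm_mul_of_mem ha).trans ?_)
  -- Only ‖1‖ ≤ 1 is available, since H may be trivial.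
  exact mul_le_of_le_one_right (norm_nonneg _) ContinuousLinearMap.norm_id_le

theorem summable_opCorr (hA : IsObservable A) (hB : IsObservable B) (hρ : IsState ρ) :
    Summable fun p : spectrum ℂ A × spectrum ℂ B =>
      (p.1 : ℂ) * (p.2 : ℂ) * opProb A B ρ p.1 p.2 := by
  obtain ⟨R, hR, hRρ, hRn⟩ := exists_sqrt_of_isPositive hρ.isPositive
  refine summable_prod_of_enorm (f := fun (a : spectrum ℂ A) (b : spectrum ℂ B) =>
    (a : ℂ) * (b : ℂ) * opProb A B ρ a b) ?_
  calc ∑' a : spectrum ℂ A, ∑' b : spectrum ℂ B, ‖(a : ℂ) * (b : ℂ) * opProb A B ρ a b‖ₑ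
    _ ≤ ∑' a : spectrum ℂ A, ∑' b : spectrum ℂ B, ‖A‖ₑ * ‖B‖ₑ *
          hsNormSq (R * spectralProj A a * spectralProj B b) := by
        refine ENNReal.tsum_le_tsum fun a => ENNReal.tsum_le_tsum fun b => ?_
        rw [enorm_mul, enorm_mul]
        gcongr
        · exact enorm_le_of_mem_spectrum a.2
        · exact enorm_le_of_mem_spectrum b.2
        · exact enorm_opProb_le hρ hR hRρ a b
    _ = ‖A‖ₑ * ‖B‖ₑ * traceNorm ρ := by
        simp_rw [ENNReal.tsum_mul_left, hB.isResolution.tsum_hsNormSq_mul,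
          hA.isResolution.tsum_hsNormSq_mul, hRn]
    _ < ∞ := ENNReal.mul_lt_top (ENNReal.mul_lt_top (by simp) (by simp)) hρ.isTraceClass

theorem luders_mul_self (hA : IsObservable A) {a : ℂ} (ha : a ∈ spectrum ℂ A) (ρ : H →L[ℂ] H) :
    luders A a ρ * A = a • luders A a ρ := by
  rw [luders, mul_assoc, spectralProj_mul hA.isSelfAdjoint ha, mul_smul_comm]

theorem mul_luders_self (A : H →L[ℂ] H) (a : ℂ) (ρ : H →L[ℂ] H) :
    A * luders A a ρ = a • luders A a ρ := by
  rw [luders, ← mul_assoc, ← mul_assoc, mul_spectralProj, smul_mul_assoc, smul_mul_assoc]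

/-- Because b P_B(b) = B P_B(b), this expands tr(Π_A(a)(ρ) B) along the resolution given by B. -/
theorem hasSum_mul_opProb (hB : IsObservable B) (hρ : IsState ρ) (a : ℂ) :
    HasSum (fun b : spectrum ℂ B => (b : ℂ) * opProb A B ρ a b) (trace (luders A a ρ * B)) := by
  convert hB.isResolution.hasSum_trace_mul ((isTraceClass_luders (A := A) hρ a).mul_right B)
    using 2 with b
  rw [opProb, mul_assoc, mul_spectralProj, mul_smul_comm, trace_smul]

theorem opCorr_eq_tsum (hA : IsObservable A) (hB : IsObservable B) (hρ : IsState ρ) :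
    opCorr A B ρ = ∑' a : spectrum ℂ A, (a : ℂ) * trace (luders A a ρ * B) := by
  rw [opCorr, (summable_opCorr hA hB hρ).tsum_prod]
  refine tsum_congr fun a => ?_
  simp_rw [mul_assoc]
  rw [tsum_mul_left, (hasSum_mul_opProb hB hρ a).tsum_eq]

theorem opCorr_eq_trace_mul (hA : IsObservable A) (hB : IsObservable B) (hρ : IsState ρ) :
    opCorr A B ρ = trace (nonselective A ρ * (A * B)) := by
  rw [opCorr_eq_tsum hA hB hρ, ← (hasSum_trace_luders_mul hA hρ (A * B)).tsum_eq]
  refine tsum_congr fun a => ?_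
  rw [← mul_assoc, luders_mul_self hA a.2, smul_mul_assoc, trace_smul]

/-- Cyclicity brings A to the left of the branch, where it also acts as a. -/
theorem opCorr_eq_trace_mul_swap (hA : IsObservable A) (hB : IsObservable B) (hρ : IsState ρ) :
    opCorr A B ρ = trace (nonselective A ρ * (B * A)) := by
  rw [opCorr_eq_tsum hA hB hρ, ← (hasSum_trace_luders_mul hA hρ (B * A)).tsum_eq]
  refine tsum_congr fun a => ?_
  rw [← mul_assoc, trace_mul_comm ((isTraceClass_luders hρ a).mul_right B), ← mul_assoc,
    mul_luders_self, smul_mul_assoc, trace_smul]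

theorem opCorr_eq_trace_mul_circ (hA : IsObservable A) (hB : IsObservable B) (hρ : IsState ρ)
    (α : ℝ) : opCorr A B ρ = trace (nonselective A ρ * circ α A B) := by
  have hΛ := isTraceClass_nonselective hA hρ
  rw [circ, mul_add, mul_smul_comm, mul_smul_comm, trace_add, trace_smul, trace_smul,
    ← opCorr_eq_trace_mul hA hB hρ, ← opCorr_eq_trace_mul_swap hA hB hρ]
  · ring
  · rw [← mul_smul_comm]; exact hΛ.mul_right _
  · rw [← mul_smul_comm]; exact hΛ.mul_right _

/-! ### The final estimates -/

theorem norm_circ_le {α : ℝ} (hα : α ∈ Set.Icc (0 : ℝ) 1) (A B : H →L[ℂ] H) :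
    ‖circ α A B‖ ≤ ‖A‖ * ‖B‖ := by
  have h1 : ‖(α : ℂ)‖ = α := by rw [Complex.norm_real, Real.norm_of_nonneg hα.1]
  have h2 : ‖(1 - α : ℂ)‖ = 1 - α := by
    rw [← Complex.ofReal_one, ← Complex.ofReal_sub, Complex.norm_real,
      Real.norm_of_nonneg (sub_nonneg.2 hα.2)]
  calc ‖circ α A B‖ ≤ ‖(α : ℂ) • (A * B)‖ + ‖(1 - α : ℂ) • (B * A)‖ := norm_add_le _ _
    _ = α * ‖A * B‖ + (1 - α) * ‖B * A‖ := by rw [norm_smul, norm_smul, h1, h2]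
    _ ≤ α * (‖A‖ * ‖B‖) + (1 - α) * (‖B‖ * ‖A‖) :=
        add_le_add (mul_le_mul_of_nonneg_left (norm_mul_le _ _) hα.1)
          (mul_le_mul_of_nonneg_left (norm_mul_le _ _) (sub_nonneg.2 hα.2))
    _ = ‖A‖ * ‖B‖ := by ring

theorem norm_opCorr_sub_algCorr_le (hA : IsObservable A) (hB : IsObservable B) (hρ : IsState ρ)
    (α : ℝ) : ‖opCorr A B ρ - algCorr α A B ρ‖ ≤ ‖circ α A B‖ * invasiveness A ρ := by
  have hΛ := isTraceClass_nonselective hA hρ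
  rw [opCorr_eq_trace_mul_circ hA hB hρ α, algCorr,
    ← trace_sub (hΛ.mul_right _) (hρ.isTraceClass.mul_right _), ← sub_mul]
  have h := ENNReal.toReal_mono (ENNReal.mul_ne_top (by simp) (hΛ.sub hρ.isTraceClass).ne)
    (enorm_trace_mul_le (nonselective A ρ - ρ) (circ α A B))
  rwa [ENNReal.toReal_mul, toReal_enorm, toReal_enorm] at h

end QuantumCorrelation

end

theorem mainTheorem2 {H : Type*} [NormedAddCommGroup H] [InnerProductSpace ℂ H] [CompleteSpace H]
    (A B ρ : H →L[ℂ] H)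
    (hA : QuantumCorrelation.IsObservable A) (hB : QuantumCorrelation.IsObservable B)
    (hρ : QuantumCorrelation.IsState ρ) :
    -- the series `Λ_A(ρ) = ∑ₐ P_A(a) ρ P_A(a)` converges unconditionally in trace norm
    Filter.Tendsto
      (fun F : Finset (spectrum ℂ A) => QuantumCorrelation.traceNorm
        (QuantumCorrelation.nonselective A ρ - ∑ a ∈ F, QuantumCorrelation.luders A a ρ))
      Filter.atTop (nhds 0) ∧
    -- the trace norm defining `Inv_A(ρ)` is finite
    QuantumCorrelation.IsTraceClass (QuantumCorrelation.nonselective A ρ - ρ) ∧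
    -- the traces defining the joint probabilities exist, and the double series defining the
    -- operational correlation converges absolutely
    (∀ a ∈ spectrum ℂ A, ∀ b ∈ spectrum ℂ B, QuantumCorrelation.IsTraceClass
      (QuantumCorrelation.luders A a ρ * QuantumCorrelation.spectralProj B b)) ∧
    Summable (fun p : spectrum ℂ A × spectrum ℂ B =>
      (p.1 : ℂ) * (p.2 : ℂ) * QuantumCorrelation.opProb A B ρ p.1 p.2) ∧
    ∀ α : ℝ,
      -- the trace defining the algebraic correlation exists
      QuantumCorrelation.IsTraceClass (ρ * QuantumCorrelation.circ α A B) ∧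
      ‖QuantumCorrelation.opCorr A B ρ - QuantumCorrelation.algCorr α A B ρ‖ ≤
        ‖QuantumCorrelation.circ α A B‖ * QuantumCorrelation.invasiveness A ρ ∧
      (α ∈ Set.Icc (0 : ℝ) 1 →
        ‖QuantumCorrelation.opCorr A B ρ - QuantumCorrelation.algCorr α A B ρ‖ ≤
          ‖A‖ * ‖B‖ * QuantumCorrelation.invasiveness A ρ) := by
  open QuantumCorrelation in
  exact ⟨tendsto_traceNorm_nonselective_sub hA hρ,
    (isTraceClass_nonselective hA hρ).sub hρ.isTraceClass,
    fun a _ b _ => (isTraceClass_luders hρ a).mul_right _, summable_opCorr hA hB hρ,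
    fun α => ⟨hρ.isTraceClass.mul_right _, norm_opCorr_sub_algCorr_le hA hB hρ α, fun hα =>
      (norm_opCorr_sub_algCorr_le hA hB hρ α).trans
        (mul_le_mul_of_nonneg_right (norm_circ_le hα A B) ENNReal.toReal_nonneg)⟩⟩
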